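/- **Proposition (convergence in probability).** Let $(\Omega,\mathcal F,(\mathbb F_n)_{n\in\mathbb N_0},\mathbb P)$ be a filtered probability space. For every $n\in\mathbb N=\{1,2,\dots\}$ let $\gamma_n\colon\Omega\to[0,\infty)$ be $\mathbb F_{n-1}$-measurable, and assume that for every $\omega\in\Omega$ it holds that $\lim_{n\to\infty}\gamma_n(\omega)=0$, that $\sum_{n=1}^\infty\gamma_n(\omega)=\infty$, and that $\gamma_{n+1}(\omega)\le\gamma_n(\omega)$ for all $n\in\mathbb N$. Let $d\in\mathbb N$, let $g\colon\mathbb R^d\to\mathbb R^d$ be measurable and locally bounded, and let $c\in(0,\infty)$ satisfy $\langle\theta,g(\theta)\rangle\le -c\|\theta\|^2$ for all $\theta\in\mathbb R^d$ (with the Euclidean inner product and norm). Let $D_n\colon\Omega\to\mathbb R^d$, $n\in\mathbb N$, be random variables such that for all $n\in\mathbb N$ it holds that $\mathbb E[\|D_n\|]<\infty$ and, $\mathbb P$-a.s., $\mathbb E[D_n\mid\mathbb F_{n-1}]=0$. Let $\Theta=(\Theta_n)_{n\in\mathbb N_0}$ be an $(\mathbb F_n)_{n\in\mathbb N_0}$-adapted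 $\mathbb R^d$-valued process which satisfies for all $n\in\mathbb N$ that $$\Theta_n=\Theta_{n-1}+\gamma_n\,g(\Theta_{n-1})+\gamma_n D_n .$$ For every $R\in\mathbb R$ let $\tau_R=\inf(\{n\in\mathbb N_0\colon\|\Theta_n\|^2\ge R\}\cup\{\infty\})$, and assume for all $R\in\mathbb R$ that $\mathbb E\bigl[\sup_{n\in\mathbb N,\,n\le\tau_R}\|D_n\|^2\bigr]<\infty$, where $\sup\emptyset=0$. For every $t\in[0,\infty)$ let $$N_t=\inf\Bigl\{n\in\mathbb N_0\colon\textstyle\sum_{m=1}^n\gamma_m\ge t\Bigr\},$$ and let $\mathcal E=\{\sup_{n\in\mathbb N}\|\Theta_n\|<\infty\}$. Then (i) for all $\delta\in(0,\infty)$ it holds that $\limsup_{n\to\infty}\mathbb E\bigl[\min\{1,\|\Theta_{N_{n\delta}}\|\mathbf 1_{\mathcal E}\}\bigr]=0$; (ii) for all $\delta\in(0,\infty)$ it holds that $\limsup_{n\to\infty}\mathbb E\bigl[\min\bigl\{1,\bigl(\max_{N_{n\delta}\le m\le N_{(n+1)\delta}}\|\Theta_m\|\bigr)\mathbf 1_{\mathcal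 E}\bigr\}\bigr]=0$; (iii) it holds that $\limsup_{t\to\infty}\mathbb E\bigl[\min\{1,\|\Theta_{N_t}\|\mathbf 1_{\mathcal E}\}\bigr]=0$, where $t$ tends to infinity along $[0,\infty)$. -/

import Mathlib

open MeasureTheory ProbabilityTheory Filter Topology
open scoped ENNReal

/-- `g` is locally bounded: every point has a neighbourhood on which `g` is bounded. -/
def SGD.LocallyBoundedFun {d : ℕ}
    (g : EuclideanSpace ℝ (Fin d) → EuclideanSpace ℝ (Fin d)) : Prop :=
  ∀ θ, ∃ U ∈ 𝓝 θ, Bornology.IsBounded (g '' U)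

/-- `τ_R = inf ({n ∈ ℕ₀ : ‖Θ_n‖² ≥ R} ∪ {∞})`. -/
noncomputable def SGD.exitTime {Ω : Type*} {d : ℕ}
    (Θ : ℕ → Ω → EuclideanSpace ℝ (Fin d)) (R : ℝ) (ω : Ω) : ℕ∞ :=
  sInf ({k : ℕ∞ | ∃ n : ℕ, k = n ∧ R ≤ ‖Θ n ω‖ ^ 2} ∪ {⊤})

/-- `N_t = inf {n ∈ ℕ₀ : γ_1 + ⋯ + γ_n ≥ t}`. The set is nonempty when the series diverges. -/
noncomputable def SGD.timeChange {Ω : Type*} (γ : ℕ → Ω → ℝ) (t : ℝ) (ω : Ω) : ℕ :=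
  sInf {n : ℕ | t ≤ ∑ m ∈ Finset.Icc 1 n, γ m ω}

/-- The event that `sup_{n ≥ 1} ‖Θ_n‖ < ∞`. -/
def SGD.boundedEvent {Ω : Type*} {d : ℕ}
    (Θ : ℕ → Ω → EuclideanSpace ℝ (Fin d)) : Set Ω :=
  {ω | (⨆ (n : ℕ) (_ : 1 ≤ n), ‖Θ n ω‖ₑ) < ∞}

/-! Write s_n = γ_1 + ⋯ + γ_n for the clock. Coercivity makes exp(2c s_n)‖Θ_n‖² a supermartingale up
to an error exp(2c s_{n+1}) γ_{n+1}² (G² + M), as long as the path stays in a ball on which ‖g‖ ≤ G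
and M dominates the squared noise (`setIntegral_exp_mul_normSq_step_le`). If all steps after n₀ are
at most ε, then γ² ≤ εγ turns the sum of the errors up to clock time T into ε times a Riemann sum of
order exp(2cT) (`sum_ite_exp_mul_sq_le`). A maximal inequality over the first passage of a level l
in the window [t, T] then gives `measure_exceed_le`: after division by exp(2ct) l the initial energy
decays in t, while for T = t + δ the error is ε times a constant independent of t. In
`tendsto_lintegral_window` the constants are therefore chosen in the order R (ball), ε, n₀, K (bound
for the clock at n₀), and t last. All three claims follow from this uniform window statement. -/

namespace SGD

/-! ### One-step estimate for the weighted second moment. -/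

section OneStep

variable {Ω E : Type*} [NormedAddCommGroup E] [InnerProductSpace ℝ E]

/-- A bounded `m`-measurable vector is orthogonal to every integrable vector whose conditional
expectation given `m` vanishes. -/
theorem integral_inner_eq_zero [CompleteSpace E] {m mΩ : MeasurableSpace Ω} {P : Measure Ω}
    [IsFiniteMeasure P] (hm : m ≤ mΩ) {V D : Ω → E} {C : ℝ} (hV : StronglyMeasurable[m] V)
    (hVC : ∀ ω, ‖V ω‖ ≤ C) (hD : Integrable D P) (hD0 : P[D | m] =ᵐ[P] 0) :
    ∫ ω, inner ℝ (V ω) (D ω) ∂P = 0 := by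
  rw [← integral_condExp hm]
  have h := condExp_stronglyMeasurable_bilin_of_bound (innerSL ℝ) hm hV hD C (ae_of_all _ hVC)
  have h' : P[fun ω => inner ℝ (V ω) (D ω) | m] =ᵐ[P] 0 := by
    filter_upwards [h, hD0] with ω h1 h2
    have h1' : (P[fun ω => inner ℝ (V ω) (D ω) | m]) ω = inner ℝ (V ω) ((P[D | m]) ω) := h1
    rw [h1', h2]; simp
  rw [integral_congr_ae h']; simp

theorem integrable_inner_of_bound {mΩ : MeasurableSpace Ω} {P : Measure Ω}
    {V D : Ω → E} {C : ℝ} (hV : AEStronglyMeasurable V P)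
    (hVC : ∀ ω, ‖V ω‖ ≤ C) (hD : Integrable D P) :
    Integrable (fun ω => inner ℝ (V ω) (D ω)) P := by
  refine (hD.norm.const_mul C).mono' (hV.inner hD.1) (ae_of_all _ fun ω => ?_)
  exact (norm_inner_le_norm _ _).trans
    (mul_le_mul_of_nonneg_right (hVC ω) (norm_nonneg _))

/-- Expand the square: the drift contributes at most -2cγ‖θ‖², and since 1 - 2cγ ≤ exp(-2cγ) this
pays for the growth of the weight. The rest is quadratic in γ, except for the term linear in `D`,
which is kept exact so that conditioning removes it. -/
theorem exp_mul_normSq_step_le {c s γ G M : ℝ} {θ h D : E} (hγ0 : 0 ≤ γ)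
    (hθh : inner ℝ θ h ≤ -c * ‖θ‖ ^ 2) (hG : ‖h‖ ≤ G) (hM : ‖D‖ ^ 2 ≤ M) :
    Real.exp (2 * c * (s + γ)) * ‖θ + γ • h + γ • D‖ ^ 2
      ≤ Real.exp (2 * c * s) * ‖θ‖ ^ 2 + Real.exp (2 * c * (s + γ)) * γ ^ 2 * (G ^ 2 + M)
        + inner ℝ ((Real.exp (2 * c * (s + γ)) * (2 * γ)) • (θ + γ • h)) D := by
  have e1 : ‖θ + γ • h + γ • D‖ ^ 2
      = ‖θ‖ ^ 2 + 2 * γ * inner ℝ θ h + γ ^ 2 * ‖h‖ ^ 2 + 2 * γ * inner ℝ (θ + γ • h) D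
        + γ ^ 2 * ‖D‖ ^ 2 := by
    rw [norm_add_sq_real, norm_add_sq_real, real_inner_smul_right, real_inner_smul_right,
      norm_smul, norm_smul, mul_pow, mul_pow, Real.norm_eq_abs, sq_abs]
    ring
  have e2 : Real.exp (2 * c * (s + γ)) * (1 - 2 * c * γ) ≤ Real.exp (2 * c * s) := by
    have h1 := Real.add_one_le_exp (-(2 * c * γ))
    calc Real.exp (2 * c * (s + γ)) * (1 - 2 * c * γ)
        ≤ Real.exp (2 * c * (s + γ)) * Real.exp (-(2 * c * γ)) := by
          gcongr; linarith
      _ = Real.exp (2 * c * s) := by rw [← Real.exp_add]; ring_nf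
  have hG2 : ‖h‖ ^ 2 ≤ G ^ 2 := by gcongr
  have hE := Real.exp_pos (2 * c * (s + γ))
  rw [real_inner_smul_left, e1]
  generalize Real.exp (2 * c * (s + γ)) = e at *
  generalize Real.exp (2 * c * s) = e' at *
  have a1 : e * (2 * γ) * inner ℝ θ h ≤ e * (2 * γ) * (-c * ‖θ‖ ^ 2) := by gcongr
  have a2 : e * γ ^ 2 * (‖h‖ ^ 2 + ‖D‖ ^ 2) ≤ e * γ ^ 2 * (G ^ 2 + M) := by gcongr
  have a3 := mul_le_mul_of_nonneg_right e2 (sq_nonneg ‖θ‖)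
  linarith

/-- One step of the recursion on an `m`-measurable event on which all the data are bounded:
the exponentially weighted second moment increases by at most a quadratic term. -/
theorem setIntegral_exp_mul_normSq_step_le [CompleteSpace E] [MeasurableSpace E] [BorelSpace E]
    [SecondCountableTopology E] {m mΩ : MeasurableSpace Ω} {P : Measure Ω} [IsFiniteMeasure P]
    (hm : m ≤ mΩ) {B : Set Ω} (hB : MeasurableSet[m] B) {c r G T : ℝ} (hc : 0 < c)
    {s γ M : Ω → ℝ} {θ h D : Ω → E} (hs : Measurable[m] s) (hγ : Measurable[m] γ)
    (hθ : Measurable[m] θ) (hh : Measurable[m] h)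
    (hs0 : ∀ ω ∈ B, 0 ≤ s ω) (hsT : ∀ ω ∈ B, s ω ≤ T)
    (hγ0 : ∀ ω ∈ B, 0 ≤ γ ω) (hγ1 : ∀ ω ∈ B, γ ω ≤ 1)
    (hθr : ∀ ω ∈ B, ‖θ ω‖ ≤ r) (hhG : ∀ ω ∈ B, ‖h ω‖ ≤ G)
    (hθh : ∀ ω ∈ B, inner ℝ (θ ω) (h ω) ≤ -c * ‖θ ω‖ ^ 2)
    (hD : Integrable D P) (hD0 : P[D | m] =ᵐ[P] 0) (hM : Integrable M P)
    (hDM : ∀ᵐ ω ∂P, ω ∈ B → ‖D ω‖ ^ 2 ≤ M ω) :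
    IntegrableOn (fun ω => Real.exp (2 * c * (s ω + γ ω))
        * ‖θ ω + γ ω • h ω + γ ω • D ω‖ ^ 2) B P ∧
    IntegrableOn (fun ω => Real.exp (2 * c * (s ω + γ ω)) * γ ω ^ 2 * (G ^ 2 + M ω)) B P ∧
    ∫ ω in B, Real.exp (2 * c * (s ω + γ ω)) * ‖θ ω + γ ω • h ω + γ ω • D ω‖ ^ 2 ∂P
      ≤ ∫ ω in B, Real.exp (2 * c * s ω) * ‖θ ω‖ ^ 2 ∂P
        + ∫ ω in B, Real.exp (2 * c * (s ω + γ ω)) * γ ω ^ 2 * (G ^ 2 + M ω) ∂P := by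
  have hB' := hm _ hB
  have hs' := hs.mono hm le_rfl
  have hγ' := hγ.mono hm le_rfl
  have hθ' := hθ.mono hm le_rfl
  have hh' := hh.mono hm le_rfl
  rcases B.eq_empty_or_nonempty with rfl | ⟨ω₀, hω₀⟩
  · simp
  have hr0 : 0 ≤ r := (norm_nonneg _).trans (hθr ω₀ hω₀)
  have hG0 : 0 ≤ G := (norm_nonneg _).trans (hhG ω₀ hω₀)
  have hexp : ∀ ω ∈ B, Real.exp (2 * c * (s ω + γ ω)) ≤ Real.exp (2 * c * (T + 1)) := by
    intro ω hω
    have := hsT ω hω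
    have := hγ1 ω hω
    gcongr
  have hexp' : ∀ ω ∈ B, Real.exp (2 * c * s ω) ≤ Real.exp (2 * c * T) := by
    intro ω hω
    have := hsT ω hω
    gcongr
  -- Cutting off to `B` makes the factor bounded everywhere and keeps it `m`-measurable, so its
  -- product with the merely integrable `D` has mean zero.
  set V : Ω → E := B.indicator fun ω =>
    (Real.exp (2 * c * (s ω + γ ω)) * (2 * γ ω)) • (θ ω + γ ω • h ω) with hV
  have hVm : StronglyMeasurable[m] V := by
    refine StronglyMeasurable.indicator ?_ hB
    apply Measurable.stronglyMeasurable
    exact (((hs.add hγ).const_mul _).exp.mul (hγ.const_mul 2)).smul (hθ.add (hγ.smul hh))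
  have hVb : ∀ ω, ‖V ω‖ ≤ Real.exp (2 * c * (T + 1)) * (2 * 1) * (r + 1 * G) := by
    intro ω
    by_cases hω : ω ∈ B
    · simp only [hV, Set.indicator_of_mem hω]
      rw [norm_smul, Real.norm_of_nonneg
        (mul_nonneg (Real.exp_pos _).le (mul_nonneg zero_le_two (hγ0 ω hω)))]
      have h1 := hexp ω hω
      have h2 := hγ1 ω hω
      have h3 := hγ0 ω hω
      have h4 : ‖θ ω + γ ω • h ω‖ ≤ r + 1 * G := by
        refine (norm_add_le _ _).trans ?_
        rw [norm_smul, Real.norm_of_nonneg h3]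
        have := hθr ω hω
        have := hhG ω hω
        gcongr
      gcongr
    · simp only [hV, Set.indicator_of_notMem hω, norm_zero]
      positivity
  have hVi := integrable_inner_of_bound (hVm.mono hm).aestronglyMeasurable hVb hD
  have hV0 := integral_inner_eq_zero hm hVm hVb hD hD0
  have i1 : IntegrableOn (fun ω => Real.exp (2 * c * s ω) * ‖θ ω‖ ^ 2) B P := by
    refine IntegrableOn.of_bound (measure_lt_top _ _) ?_ (Real.exp (2 * c * T) * r ^ 2) ?_
    · exact ((hs'.const_mul _).exp.mul (hθ'.norm.pow_const 2)).aestronglyMeasurable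
    · refine (ae_restrict_iff' hB').2 (ae_of_all _ fun ω hω => ?_)
      rw [Real.norm_of_nonneg (by positivity)]
      have := hexp' ω hω
      have := hθr ω hω
      gcongr
  have i2 : IntegrableOn
      (fun ω => Real.exp (2 * c * (s ω + γ ω)) * γ ω ^ 2 * (G ^ 2 + M ω)) B P := by
    refine Integrable.bdd_mul (c := Real.exp (2 * c * (T + 1)) * 1 ^ 2)
      (((integrable_const (G ^ 2)).add hM).integrableOn) ?_ ?_
    · exact (((hs'.add hγ').const_mul _).exp.mul (hγ'.pow_const 2)).aestronglyMeasurable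
    · refine (ae_restrict_iff' hB').2 (ae_of_all _ fun ω hω => ?_)
      rw [Real.norm_of_nonneg (by positivity)]
      have := hexp ω hω
      have := hγ0 ω hω
      have := hγ1 ω hω
      gcongr
  have i3 : IntegrableOn (fun ω => inner ℝ (V ω) (D ω)) B P := hVi.integrableOn
  have hle : ∀ᵐ ω ∂P.restrict B,
      Real.exp (2 * c * (s ω + γ ω)) * ‖θ ω + γ ω • h ω + γ ω • D ω‖ ^ 2
      ≤ Real.exp (2 * c * s ω) * ‖θ ω‖ ^ 2
        + Real.exp (2 * c * (s ω + γ ω)) * γ ω ^ 2 * (G ^ 2 + M ω)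
        + inner ℝ (V ω) (D ω) := by
    refine (ae_restrict_iff' hB').2 ?_
    filter_upwards [hDM] with ω hω hωB
    simp only [hV, Set.indicator_of_mem hωB]
    exact exp_mul_normSq_step_le (hγ0 ω hωB) (hθh ω hωB) (hhG ω hωB) (hω hωB)
  -- Square integrability of `D` is not assumed: integrability comes from nonnegativity and the
  -- upper bound `hle`.
  have i0 : IntegrableOn (fun ω => Real.exp (2 * c * (s ω + γ ω))
      * ‖θ ω + γ ω • h ω + γ ω • D ω‖ ^ 2) B P := by
    refine Integrable.mono' ((i1.add i2).add i3) ?_ ?_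
    · refine AEStronglyMeasurable.mul
        (((hs'.add hγ').const_mul _).exp).aestronglyMeasurable ?_
      have hDm : AEStronglyMeasurable D (P.restrict B) := hD.1.restrict
      exact ((((hθ'.add (hγ'.smul hh')).aestronglyMeasurable).add
        (hγ'.aestronglyMeasurable.smul hDm)).norm.pow 2)
    · filter_upwards [hle] with ω hω
      rw [Real.norm_of_nonneg (by positivity)]
      exact hω
  refine ⟨i0, i2, ?_⟩
  have hV0' : ∫ ω in B, inner ℝ (V ω) (D ω) ∂P = 0 := by
    rw [← hV0]
    refine setIntegral_eq_integral_of_forall_compl_eq_zero fun ω hω => ?_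
    simp [hV, Set.indicator_of_notMem hω]
  have := integral_mono_ae i0 ((i1.add i2).add i3) hle
  have e : ∫ ω in B, (Real.exp (2 * c * s ω) * ‖θ ω‖ ^ 2
        + Real.exp (2 * c * (s ω + γ ω)) * γ ω ^ 2 * (G ^ 2 + M ω)
        + inner ℝ (V ω) (D ω)) ∂P = _ := integral_add (i1.add i2) i3
  have e' : ∫ ω in B, (Real.exp (2 * c * s ω) * ‖θ ω‖ ^ 2
        + Real.exp (2 * c * (s ω + γ ω)) * γ ω ^ 2 * (G ^ 2 + M ω)) ∂P = _ := integral_add i1 i2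
  simp only [Pi.add_apply] at this e e'
  linarith

end OneStep

/-! ### Summation along stopped paths and over first-passage events. -/

/-- The sum telescopes until `p` first fails and is constant afterwards. The induction also carries
the sharper bound `φ k`, valid while `p` holds. -/
theorem sum_ite_sub_le {p : ℕ → Prop} [DecidablePred p] {φ : ℕ → ℝ} {L : ℝ}
    (hp : ∀ j, p (j + 1) → p j) (hφ : 0 ≤ φ 0) (hL : 0 ≤ L) (hpL : ∀ j, p j → φ (j + 1) ≤ L)
    (k : ℕ) : ∑ j ∈ Finset.range k, (if p j then φ (j + 1) - φ j else 0) ≤ L := by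
  suffices h : ∑ j ∈ Finset.range k, (if p j then φ (j + 1) - φ j else 0) ≤ L ∧
      (p k → ∑ j ∈ Finset.range k, (if p j then φ (j + 1) - φ j else 0) ≤ φ k) from h.1
  induction k with
  | zero => simpa using ⟨hL, fun _ => hφ⟩
  | succ k ih =>
    rw [Finset.sum_range_succ]
    by_cases hk : p k
    · have h1 := ih.2 hk
      have h2 := hpL k hk
      simp only [hk, if_true]
      exact ⟨by linarith, fun _ => by linarith⟩
    · simp only [hk, if_false, add_zero]
      exact ⟨ih.1, fun h => absurd (hp k h) hk⟩

/-- Along a stopped path, the quadratic increments are controlled by the largest step size. -/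
theorem sum_ite_exp_mul_sq_le {p : ℕ → Prop} [DecidablePred p] {s γ : ℕ → ℝ} {c ε T : ℝ}
    (hc : 0 < c) (hε0 : 0 ≤ ε) (hε1 : ε ≤ 1) (hp : ∀ j, p (j + 1) → p j)
    (hs : ∀ j, s (j + 1) = s j + γ j) (hγ0 : ∀ j, 0 ≤ γ j) (hγε : ∀ j, p j → γ j ≤ ε)
    (hT : ∀ j, p j → s j < T) (k : ℕ) :
    ∑ j ∈ Finset.range k, (if p j then Real.exp (2 * c * (s j + γ j)) * γ j ^ 2 else 0)
      ≤ ε * (Real.exp (2 * c * (T + 2)) / (2 * c)) := by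
  have hA : 0 ≤ ε * (Real.exp (2 * c) / (2 * c)) := by positivity
  -- Uses γ² ≤ εγ and 2cγ ≤ exp(2cγ) - 1 to reach a telescoping sum. Of the 2 in `T + 2`, one unit
  -- replaces the weight at s + γ by that at s, the other covers the overshoot of the last step
  -- beyond `T`.
  have h1 : ∀ j, (if p j then Real.exp (2 * c * (s j + γ j)) * γ j ^ 2 else 0)
      ≤ ε * (Real.exp (2 * c) / (2 * c)) *
        (if p j then Real.exp (2 * c * s (j + 1)) - Real.exp (2 * c * s j) else 0) := by
    intro j
    split_ifs with hj
    · have g0 := hγ0 j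
      have g1 := hγε j hj
      have e1 := Real.add_one_le_exp (2 * c * γ j)
      have e2 : Real.exp (2 * c * (s j + γ j)) ≤ Real.exp (2 * c) * Real.exp (2 * c * s j) := by
        rw [← Real.exp_add]
        have : 2 * c * γ j ≤ 2 * c * 1 := by gcongr; linarith
        gcongr; linarith
      have e3 : Real.exp (2 * c * s (j + 1)) - Real.exp (2 * c * s j)
          = Real.exp (2 * c * s j) * (Real.exp (2 * c * γ j) - 1) := by
        rw [hs, mul_add, Real.exp_add]; ring
      rw [e3]
      calc Real.exp (2 * c * (s j + γ j)) * γ j ^ 2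
          = γ j * (Real.exp (2 * c * (s j + γ j)) * (2 * c * γ j)) / (2 * c) := by
            field_simp
        _ ≤ ε * ((Real.exp (2 * c) * Real.exp (2 * c * s j)) * (Real.exp (2 * c * γ j) - 1))
            / (2 * c) := by
            have : 2 * c * γ j ≤ Real.exp (2 * c * γ j) - 1 := by linarith
            gcongr
        _ = _ := by ring
    · simp
  refine (Finset.sum_le_sum fun j _ => h1 j).trans ?_
  rw [← Finset.mul_sum]
  have h2 := sum_ite_sub_le (φ := fun j => Real.exp (2 * c * s j))
    (L := Real.exp (2 * c * (T + 1))) hp (Real.exp_pos _).le (Real.exp_pos _).le (fun j hj => by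
      have := hγε j hj
      have := hT j hj
      rw [hs]
      gcongr
      linarith) k
  refine (mul_le_mul_of_nonneg_left h2 hA).trans (le_of_eq ?_)
  rw [show 2 * c * (T + 2) = 2 * c + 2 * c * (T + 1) by ring, Real.exp_add]
  ring

/-- Summation of one-step estimates on a decreasing sequence of events `B`, where on leaving `B`
through `C` the quantity `Z` is at least `z`. -/
theorem sum_measureReal_le_of_step {Ω : Type*} [MeasurableSpace Ω] {P : Measure Ω}
    [IsFiniteMeasure P] {B C : ℕ → Set Ω} {Z F : ℕ → Ω → ℝ} {z : ℝ}
    (hB : ∀ n, MeasurableSet (B n)) (hC : ∀ n, MeasurableSet (C n))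
    (hBB : ∀ n, B (n + 1) ⊆ B n) (hCB : ∀ n, C n ⊆ B n) (hdisj : ∀ n, Disjoint (B (n + 1)) (C n))
    (hZ : ∀ n ω, 0 ≤ Z n ω) (hzC : ∀ n, ∀ ω ∈ C n, z ≤ Z (n + 1) ω)
    (hint : ∀ n, IntegrableOn (Z (n + 1)) (B n) P)
    (hstep : ∀ n, ∫ ω in B n, Z (n + 1) ω ∂P ≤ ∫ ω in B n, Z n ω ∂P + ∫ ω in B n, F n ω ∂P)
    (k : ℕ) :
    z * ∑ j ∈ Finset.range k, P.real (C j)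
      ≤ ∫ ω in B 0, Z 0 ω ∂P + ∑ j ∈ Finset.range k, ∫ ω in B j, F j ω ∂P := by
  -- The mass still active is kept on the left for the induction and dropped at the end.
  suffices h : ∫ ω in B k, Z k ω ∂P + z * ∑ j ∈ Finset.range k, P.real (C j)
      ≤ ∫ ω in B 0, Z 0 ω ∂P + ∑ j ∈ Finset.range k, ∫ ω in B j, F j ω ∂P by
    have := setIntegral_nonneg (μ := P) (hB k) fun ω _ => hZ k ω
    linarith
  induction k with
  | zero => simp
  | succ k ih =>
    rw [Finset.sum_range_succ, Finset.sum_range_succ]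
    have h1 : ∫ ω in B (k + 1) ∪ C k, Z (k + 1) ω ∂P ≤ ∫ ω in B k, Z (k + 1) ω ∂P :=
      setIntegral_mono_set (hint k) (ae_of_all _ (hZ (k + 1)))
        (Set.union_subset (hBB k) (hCB k)).eventuallyLE
    rw [setIntegral_union (hdisj k) (hC k) ((hint k).mono_set (hBB k))
      ((hint k).mono_set (hCB k))] at h1
    have h2 : z * P.real (C k) ≤ ∫ ω in C k, Z (k + 1) ω ∂P := by
      have := setIntegral_mono_on (integrableOn_const (C := z) (measure_ne_top P (C k)))
        ((hint k).mono_set (hCB k)) (hC k) (hzC k)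
      simpa [mul_comm] using this
    have h3 := hstep k
    linarith

/-! ### The clock and its inverse. -/

/-- The elapsed time `γ_1 + ⋯ + γ_n`. -/
noncomputable def elapsed {Ω : Type*} (γ : ℕ → Ω → ℝ) (n : ℕ) (ω : Ω) : ℝ :=
  ∑ m ∈ Finset.Icc 1 n, γ m ω

section Elapsed

variable {Ω : Type*} {γ : ℕ → Ω → ℝ}

theorem elapsed_succ (n : ℕ) (ω : Ω) : elapsed γ (n + 1) ω = elapsed γ n ω + γ (n + 1) ω :=
  Finset.sum_Icc_succ_top (by omega) _

theorem elapsed_mono (hγ : ∀ n ω, 0 ≤ γ (n + 1) ω) (ω : Ω) : Monotone fun n => elapsed γ n ω :=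
  monotone_nat_of_le_succ fun n => by rw [elapsed_succ]; linarith [hγ n ω]

theorem elapsed_nonneg (hγ : ∀ n ω, 0 ≤ γ (n + 1) ω) (n : ℕ) (ω : Ω) : 0 ≤ elapsed γ n ω := by
  simpa [elapsed] using elapsed_mono hγ ω (Nat.zero_le n)

theorem measurable_elapsed_succ {mΩ : MeasurableSpace Ω} {ℱ : Filtration ℕ mΩ}
    (hγ : ∀ n, Measurable[ℱ n] (γ (n + 1))) (n : ℕ) : Measurable[ℱ n] (elapsed γ (n + 1)) := by
  refine Finset.measurable_sum _ fun m hm => ?_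
  obtain ⟨h1, h2⟩ := Finset.mem_Icc.1 hm
  obtain ⟨k, rfl⟩ : ∃ k, m = k + 1 := ⟨m - 1, by omega⟩
  exact (hγ k).mono (ℱ.mono (by omega)) le_rfl

theorem measurable_elapsed {mΩ : MeasurableSpace Ω} {ℱ : Filtration ℕ mΩ}
    (hγ : ∀ n, Measurable[ℱ n] (γ (n + 1))) (n : ℕ) : Measurable[ℱ n] (elapsed γ n) := by
  cases n with
  | zero =>
    have h : elapsed γ 0 = fun _ => 0 := by funext ω; simp [elapsed]
    rw [h]
    exact measurable_const
  | succ n => exact (measurable_elapsed_succ hγ n).mono (ℱ.mono (by omega)) le_rfl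

theorem le_elapsed_of_timeChange_le (hγ : ∀ n ω, 0 ≤ γ (n + 1) ω) {t : ℝ} {ω : Ω}
    (htop : Tendsto (fun n => elapsed γ n ω) atTop atTop) {m : ℕ} (hm : timeChange γ t ω ≤ m) :
    t ≤ elapsed γ m ω := by
  have hne : {n : ℕ | t ≤ ∑ m ∈ Finset.Icc 1 n, γ m ω}.Nonempty :=
    (htop.eventually_ge_atTop t).exists
  exact (Nat.sInf_mem hne).trans (elapsed_mono hγ ω hm)

theorem elapsed_lt_of_lt_timeChange {t : ℝ} {ω : Ω} {m : ℕ} (hm : m < timeChange γ t ω) :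
    elapsed γ m ω < t :=
  not_le.1 (Nat.notMem_of_lt_sInf hm)

end Elapsed

/-! ### Maximal inequality on a clock window. -/

/-- The event that at time `n` the path has stayed in the ball `‖θ‖² < R`, the clock has not yet
reached `T`, and since the clock has passed `t` the level `‖θ‖² ≥ l` has not been hit. -/
def activeEvent {Ω E : Type*} [Norm E] (γ : ℕ → Ω → ℝ) (Θ : ℕ → Ω → E) (n₀ : ℕ)
    (ε K R T t l : ℝ) (n : ℕ) : Set Ω :=
  {ω | γ (n₀ + 1) ω ≤ ε} ∩ {ω | elapsed γ n₀ ω ≤ K} ∩ {ω | elapsed γ n ω < T} ∩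
    ⋂ k ≤ n, {ω | ‖Θ k ω‖ ^ 2 < R ∧ (t ≤ elapsed γ k ω → ‖Θ k ω‖ ^ 2 < l)}

theorem mem_activeEvent {Ω E : Type*} [Norm E] {γ : ℕ → Ω → ℝ} {Θ : ℕ → Ω → E} {n₀ n : ℕ}
    {ε K R T t l : ℝ} {ω : Ω} : ω ∈ activeEvent γ Θ n₀ ε K R T t l n ↔
      γ (n₀ + 1) ω ≤ ε ∧ elapsed γ n₀ ω ≤ K ∧ elapsed γ n ω < T ∧
        ∀ k ≤ n, ‖Θ k ω‖ ^ 2 < R ∧ (t ≤ elapsed γ k ω → ‖Θ k ω‖ ^ 2 < l) := by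
  simp [activeEvent, and_assoc]

theorem measurableSet_activeEvent {Ω E : Type*} [MeasurableSpace Ω] [NormedAddCommGroup E]
    [MeasurableSpace E] [BorelSpace E] {γ : ℕ → Ω → ℝ} {Θ : ℕ → Ω → E} {n₀ n : ℕ}
    (hγ : Measurable (γ (n₀ + 1))) (hs₀ : Measurable (elapsed γ n₀))
    (hs : ∀ k ≤ n, Measurable (elapsed γ k)) (hΘ : ∀ k ≤ n, Measurable (Θ k))
    (ε K R T t l : ℝ) :
    MeasurableSet (activeEvent γ Θ n₀ ε K R T t l n) := by
  refine (((measurableSet_le hγ measurable_const).inter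
    (measurableSet_le hs₀ measurable_const)).inter
    (measurableSet_lt (hs n le_rfl) measurable_const)).inter
    (MeasurableSet.iInter fun k => MeasurableSet.iInter fun hk => ?_)
  have h1 : Measurable fun ω => ‖Θ k ω‖ ^ 2 := (hΘ k hk).norm.pow_const 2
  have h5 : MeasurableSet {ω | t ≤ elapsed γ k ω} := measurableSet_le measurable_const (hs k hk)
  exact (measurableSet_lt h1 measurable_const).inter
    (h5.imp (measurableSet_lt h1 measurable_const))

/-- Quantitative bound for the probability that a stochastic gradient path which stays in a ball
exceeds the level `l` during a window of the clock. -/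
theorem measure_exceed_le {Ω E : Type*} {mΩ : MeasurableSpace Ω} {P : Measure Ω}
    [IsProbabilityMeasure P] [NormedAddCommGroup E] [InnerProductSpace ℝ E] [CompleteSpace E]
    [MeasurableSpace E] [BorelSpace E] [SecondCountableTopology E] {ℱ : Filtration ℕ mΩ}
    {γ : ℕ → Ω → ℝ} {Θ D : ℕ → Ω → E} {g : E → E} {M : Ω → ℝ} {c G R : ℝ}
    (hγ_nonneg : ∀ n ω, 0 ≤ γ (n + 1) ω) (hγ_meas : ∀ n, Measurable[ℱ n] (γ (n + 1)))
    (hγ_anti : ∀ n ω, γ (n + 2) ω ≤ γ (n + 1) ω)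
    (hg_meas : Measurable g) (hc : 0 < c) (hg_coer : ∀ θ, inner ℝ θ (g θ) ≤ -c * ‖θ‖ ^ 2)
    (hgG : ∀ θ, ‖θ‖ ^ 2 < R → ‖g θ‖ ≤ G)
    (hD_int : ∀ n, Integrable (D (n + 1)) P) (hD_mart : ∀ n, P[D (n + 1) | ℱ n] =ᵐ[P] 0)
    (hΘ_adapted : ∀ n, Measurable[ℱ n] (Θ n))
    (hΘ_rec : ∀ n ω, Θ (n + 1) ω
      = Θ n ω + γ (n + 1) ω • g (Θ n ω) + γ (n + 1) ω • D (n + 1) ω)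
    (hM : Integrable M P) (hM0 : ∀ ω, 0 ≤ M ω)
    (hDM : ∀ n, ∀ᵐ ω ∂P, (∀ k ≤ n, ‖Θ k ω‖ ^ 2 < R) → ‖D (n + 1) ω‖ ^ 2 ≤ M ω)
    (n₀ : ℕ) {ε K T t l : ℝ} (hR : 0 ≤ R) (hε0 : 0 ≤ ε) (hε1 : ε ≤ 1) (hKt : K < t) (hl : 0 < l) :
    P {ω | γ (n₀ + 1) ω ≤ ε ∧ elapsed γ n₀ ω ≤ K ∧ (∀ k, ‖Θ k ω‖ ^ 2 < R) ∧
        ∃ m, t ≤ elapsed γ m ω ∧ (∀ j < m, elapsed γ j ω < T) ∧ l ≤ ‖Θ m ω‖ ^ 2}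
      ≤ ENNReal.ofReal ((Real.exp (2 * c * K) * R
          + ε * (Real.exp (2 * c * (T + 2)) / (2 * c)) * ∫ ω, (G ^ 2 + M ω) ∂P)
          / (Real.exp (2 * c * t) * l)) := by
  classical
  set B : ℕ → Set Ω := fun j => activeEvent γ Θ n₀ ε K R T t l (n₀ + j) with hB
  set C : ℕ → Set Ω := fun j =>
    B j ∩ {ω | t ≤ elapsed γ (n₀ + j + 1) ω ∧ l ≤ ‖Θ (n₀ + j + 1) ω‖ ^ 2} with hC
  set Z : ℕ → Ω → ℝ := fun j ω => Real.exp (2 * c * elapsed γ (n₀ + j) ω) * ‖Θ (n₀ + j) ω‖ ^ 2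
    with hZ
  set F : ℕ → Ω → ℝ := fun j ω => Real.exp (2 * c * (elapsed γ (n₀ + j) ω + γ (n₀ + j + 1) ω))
    * γ (n₀ + j + 1) ω ^ 2 * (G ^ 2 + M ω) with hF
  have hBm' : ∀ j, MeasurableSet[ℱ (n₀ + j)] (B j) := fun j =>
    @measurableSet_activeEvent Ω E (ℱ (n₀ + j)) _ _ _ γ Θ n₀ (n₀ + j)
      ((hγ_meas n₀).mono (ℱ.mono (Nat.le_add_right _ _)) le_rfl)
      ((measurable_elapsed hγ_meas n₀).mono (ℱ.mono (Nat.le_add_right _ _)) le_rfl)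
      (fun k hk => (measurable_elapsed hγ_meas k).mono (ℱ.mono hk) le_rfl)
      (fun k hk => (hΘ_adapted k).mono (ℱ.mono hk) le_rfl) ε K R T t l
  have hBm : ∀ j, MeasurableSet (B j) := fun j => ℱ.le _ _ (hBm' j)
  have hΘm : ∀ n, Measurable (Θ n) := fun n => (hΘ_adapted n).mono (ℱ.le n) le_rfl
  have hsm : ∀ n, Measurable (elapsed γ n) := fun n =>
    (measurable_elapsed hγ_meas n).mono (ℱ.le n) le_rfl
  have hCm : ∀ j, MeasurableSet (C j) := fun j => (hBm j).inter
    ((measurableSet_le measurable_const (hsm _)).inter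
      (measurableSet_le measurable_const ((hΘm _).norm.pow_const 2)))
  have hBB : ∀ j, B (j + 1) ⊆ B j := by
    intro j ω hω
    obtain ⟨h1, h2, h3, h4⟩ := mem_activeEvent.1 hω
    exact mem_activeEvent.2 ⟨h1, h2, (elapsed_mono hγ_nonneg ω (by omega)).trans_lt h3,
      fun k hk => h4 k (by omega)⟩
  have hCB : ∀ j, C j ⊆ B j := fun j => Set.inter_subset_left
  have hdisj : ∀ j, Disjoint (B (j + 1)) (C j) := by
    refine fun j => Set.disjoint_left.2 fun ω hω hω' => ?_
    exact absurd (((mem_activeEvent.1 hω).2.2.2 _ le_rfl).2 hω'.2.1) (not_lt.2 hω'.2.2)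
  have hγε : ∀ j ω, ω ∈ B j → γ (n₀ + j + 1) ω ≤ ε := by
    intro j ω hω
    have : ∀ j, γ (n₀ + j + 1) ω ≤ γ (n₀ + 1) ω := by
      intro j
      induction j with
      | zero => rfl
      | succ j ih => exact (hγ_anti (n₀ + j) ω).trans ih
    exact (this j).trans (mem_activeEvent.1 hω).1
  have step := fun j => setIntegral_exp_mul_normSq_step_le (P := P) (ℱ.le (n₀ + j)) (hBm' j)
    (c := c) (r := Real.sqrt R) (G := G) (T := T) hc (measurable_elapsed hγ_meas (n₀ + j))
    (hγ_meas (n₀ + j)) (hΘ_adapted (n₀ + j)) (hg_meas.comp (hΘ_adapted (n₀ + j)))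
    (fun ω _ => elapsed_nonneg hγ_nonneg _ ω) (fun ω hω => (mem_activeEvent.1 hω).2.2.1.le)
    (fun ω _ => hγ_nonneg _ ω) (fun ω hω => (hγε j ω hω).trans hε1)
    (fun ω hω => Real.le_sqrt_of_sq_le ((mem_activeEvent.1 hω).2.2.2 _ le_rfl).1.le)
    (fun ω hω => hgG _ ((mem_activeEvent.1 hω).2.2.2 _ le_rfl).1) (fun ω _ => hg_coer _)
    (hD_int (n₀ + j)) (hD_mart (n₀ + j)) hM (by
      filter_upwards [hDM (n₀ + j)] with ω h hω
      exact h fun k hk => ((mem_activeEvent.1 hω).2.2.2 k hk).1)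
  have hZs : ∀ j, Z (j + 1) = fun ω =>
      Real.exp (2 * c * (elapsed γ (n₀ + j) ω + γ (n₀ + j + 1) ω))
        * ‖Θ (n₀ + j) ω + γ (n₀ + j + 1) ω • (g ∘ Θ (n₀ + j)) ω
          + γ (n₀ + j + 1) ω • D (n₀ + j + 1) ω‖ ^ 2 := by
    intro j
    funext ω
    simp only [hZ, ← add_assoc, elapsed_succ, hΘ_rec, Function.comp_apply]
  have hzC : ∀ j, ∀ ω ∈ C j, Real.exp (2 * c * t) * l ≤ Z (j + 1) ω := by
    rintro j ω ⟨-, h1, h2⟩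
    have h1' : t ≤ elapsed γ (n₀ + (j + 1)) ω := h1
    have h2' : l ≤ ‖Θ (n₀ + (j + 1)) ω‖ ^ 2 := h2
    simp only [hZ]
    gcongr
  have hsum := sum_measureReal_le_of_step (P := P) (F := F) hBm hCm hBB hCB hdisj
    (fun j ω => by positivity) hzC
    (fun j => by rw [hZs]; exact (step j).1) (fun j => by rw [hZs]; exact (step j).2.2)
  have hB0 : ∫ ω in B 0, Z 0 ω ∂P ≤ Real.exp (2 * c * K) * R := by
    have hb : ∀ ω ∈ B 0, ‖Z 0 ω‖ ≤ Real.exp (2 * c * K) * R := by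
      intro ω hω
      have h1 := (mem_activeEvent.1 hω).2.1
      have h2 := ((mem_activeEvent.1 hω).2.2.2 _ le_rfl).1.le
      rw [Real.norm_of_nonneg (by positivity)]
      simp only [hZ, add_zero] at h2 ⊢
      gcongr
    refine (le_abs_self _).trans
      ((norm_setIntegral_le_of_norm_le_const (measure_lt_top P _) hb).trans ?_)
    exact mul_le_of_le_one_right (by positivity) measureReal_le_one
  have hFsum : ∀ k, ∑ j ∈ Finset.range k, ∫ ω in B j, F j ω ∂P
      ≤ ε * (Real.exp (2 * c * (T + 2)) / (2 * c)) * ∫ ω, (G ^ 2 + M ω) ∂P := by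
    intro k
    -- With indicators the sum moves inside the integral, where the random factor G² + M is common
    -- to all terms and the pathwise bound applies.
    simp_rw [fun j => (integral_indicator (μ := P) (f := F j) (hBm j)).symm]
    have hi : ∀ j, Integrable ((B j).indicator (F j)) P := fun j =>
      (integrable_indicator_iff (hBm j)).2 (step j).2.1
    rw [← integral_finsetSum _ fun j _ => hi j, ← integral_const_mul]
    refine integral_mono (integrable_finsetSum _ fun j _ => hi j)
      (((integrable_const _).add hM).const_mul _) fun ω => ?_
    have h1 := sum_ite_exp_mul_sq_le (p := fun j => ω ∈ B j)
      (s := fun j => elapsed γ (n₀ + j) ω) (γ := fun j => γ (n₀ + j + 1) ω) (T := T) hc hε0 hε1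
      (fun j h => hBB j h) (fun j => elapsed_succ _ _) (fun j => hγ_nonneg _ _)
      (fun j h => hγε j ω h) (fun j h => (mem_activeEvent.1 h).2.2.1) k
    have h2 : 0 ≤ G ^ 2 + M ω := add_nonneg (sq_nonneg _) (hM0 ω)
    refine le_trans (le_of_eq ?_) (mul_le_mul_of_nonneg_right h1 h2)
    rw [Finset.sum_mul]
    refine Finset.sum_congr rfl fun j _ => ?_
    by_cases hj : ω ∈ B j <;> simp [hj, hF]
  have hsub : {ω | γ (n₀ + 1) ω ≤ ε ∧ elapsed γ n₀ ω ≤ K ∧ (∀ k, ‖Θ k ω‖ ^ 2 < R) ∧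
      ∃ m, t ≤ elapsed γ m ω ∧ (∀ j < m, elapsed γ j ω < T) ∧ l ≤ ‖Θ m ω‖ ^ 2} ⊆ ⋃ j, C j := by
    rintro ω ⟨h1, h2, h3, hex⟩
    obtain ⟨h4, h5, h6⟩ := Nat.find_spec hex
    set m := Nat.find hex
    -- The clock at n₀ is at most `K < t`, so the first exceedance in the window comes after n₀ and
    -- is one of the events `C j`.
    have hm : n₀ < m := by
      by_contra hcon
      have := elapsed_mono hγ_nonneg ω (not_lt.1 hcon)
      simp only at this
      linarith
    obtain ⟨j, hj⟩ : ∃ j, m = n₀ + j + 1 := ⟨m - n₀ - 1, by omega⟩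
    refine Set.mem_iUnion.2 ⟨j, mem_activeEvent.2 ⟨h1, h2, h5 _ (by omega), fun k hk =>
      ⟨h3 k, fun htk => ?_⟩⟩, by rw [← hj]; exact h4, by rw [← hj]; exact h6⟩
    by_contra hcon
    exact Nat.find_min hex (show k < m by omega)
      ⟨htk, fun i hi => h5 i (by omega), not_lt.1 hcon⟩
  refine (measure_mono hsub).trans ((measure_iUnion_le _).trans ?_)
  refine ENNReal.tsum_le_of_sum_range_le fun k => ?_
  simp_rw [fun j => (ofReal_measureReal (measure_ne_top P (C j))).symm]
  rw [← ENNReal.ofReal_sum_of_nonneg fun j _ => measureReal_nonneg]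
  refine ENNReal.ofReal_le_ofReal ((le_div_iff₀ (by positivity)).2 ?_)
  have := hsum k
  have := hFsum k
  linarith

/-! ### Consequences of the local hypotheses. -/

theorem LocallyBoundedFun.exists_bound {d : ℕ}
    {g : EuclideanSpace ℝ (Fin d) → EuclideanSpace ℝ (Fin d)} (hg : LocallyBoundedFun g) (R : ℝ) :
    ∃ G, ∀ θ, ‖θ‖ ^ 2 < R → ‖g θ‖ ≤ G := by
  have h : Bornology.IsBounded (g '' Metric.closedBall 0 (Real.sqrt R)) := by
    refine (isCompact_closedBall 0 (Real.sqrt R)).induction_on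
      (p := fun s => Bornology.IsBounded (g '' s)) ?_ ?_ ?_ ?_
    · simp
    · exact fun s t hst ht => ht.subset (Set.image_mono hst)
    · intro s t hs ht
      rw [Set.image_union]
      exact hs.union ht
    · intro θ _
      obtain ⟨U, hU, hb⟩ := hg θ
      exact ⟨U, mem_nhdsWithin_of_mem_nhds hU, hb⟩
  obtain ⟨G, hG⟩ := h.exists_norm_le
  refine ⟨G, fun θ hθ => hG _ ⟨θ, ?_, rfl⟩⟩
  rw [mem_closedBall_zero_iff]
  exact Real.le_sqrt_of_sq_le hθ.le

/-- The supremum of the noise includes the index τ_R itself, so it also covers the step by which the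
path leaves the ball. -/
theorem succ_le_exitTime {Ω : Type*} {d : ℕ} {Θ : ℕ → Ω → EuclideanSpace ℝ (Fin d)} {R : ℝ}
    {ω : Ω} {n : ℕ} (h : ∀ k ≤ n, ‖Θ k ω‖ ^ 2 < R) :
    ((n + 1 : ℕ) : ℕ∞) ≤ exitTime Θ R ω := by
  refine le_sInf ?_
  rintro b (⟨k, rfl, hk⟩ | rfl)
  · refine Nat.cast_le.2 (not_lt.1 fun hkn => ?_)
    exact absurd (h k (by omega)) (not_lt.2 hk)
  · exact le_top

theorem exists_integrable_bound {Ω : Type*} {mΩ : MeasurableSpace Ω} {P : Measure Ω} {d : ℕ}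
    {Θ D : ℕ → Ω → EuclideanSpace ℝ (Fin d)} {R : ℝ}
    (hΘ : ∀ n, Measurable (Θ n)) (hD : ∀ n, Measurable (D (n + 1)))
    (hsup : (∫⁻ ω, ⨆ (n : ℕ) (_ : 1 ≤ n) (_ : (n : ℕ∞) ≤ exitTime Θ R ω), ‖D n ω‖ₑ ^ 2 ∂P) < ∞) :
    ∃ M : Ω → ℝ, Integrable M P ∧ (∀ ω, 0 ≤ M ω) ∧
      ∀ n, ∀ᵐ ω ∂P, (∀ k ≤ n, ‖Θ k ω‖ ^ 2 < R) → ‖D (n + 1) ω‖ ^ 2 ≤ M ω := by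
  -- A countable supremum over events of staying in the ball: measurable by construction, and below
  -- the supremum up to `exitTime`.
  set S : Ω → ℝ≥0∞ := fun ω => ⨆ n : ℕ, {ω | ∀ k ≤ n, ‖Θ k ω‖ ^ 2 < R}.indicator
    (fun ω => ‖D (n + 1) ω‖ₑ ^ 2) ω with hS
  have hSm : Measurable S := by
    refine Measurable.iSup fun n => ((hD n).enorm.pow_const 2).indicator ?_
    simp only [Set.ofPred_forall]
    exact MeasurableSet.iInter fun k => MeasurableSet.iInter fun _ =>
      measurableSet_lt ((hΘ k).norm.pow_const 2) measurable_const
  have hSle : ∀ ω, S ω ≤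
      ⨆ (n : ℕ) (_ : 1 ≤ n) (_ : (n : ℕ∞) ≤ exitTime Θ R ω), ‖D n ω‖ₑ ^ 2 := by
    refine fun ω => iSup_le fun n => ?_
    by_cases h : ω ∈ {ω | ∀ k ≤ n, ‖Θ k ω‖ ^ 2 < R}
    · rw [Set.indicator_of_mem h]
      exact le_iSup_of_le (n + 1) (le_iSup_of_le (by omega)
        (le_iSup_of_le (succ_le_exitTime h) le_rfl))
    · simp [Set.indicator_of_notMem h]
  have hSi : ∫⁻ ω, S ω ∂P ≠ ∞ := ((lintegral_mono hSle).trans_lt hsup).ne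
  refine ⟨fun ω => (S ω).toReal, integrable_toReal_of_lintegral_ne_top hSm.aemeasurable hSi,
    fun ω => ENNReal.toReal_nonneg, fun n => ?_⟩
  filter_upwards [ae_lt_top hSm hSi] with ω hω h
  have h1 : ‖D (n + 1) ω‖ₑ ^ 2 ≤ S ω := by
    refine le_iSup_of_le n ?_
    rw [Set.indicator_of_mem (show ω ∈ {ω | ∀ k ≤ n, ‖Θ k ω‖ ^ 2 < R} from h)]
  have h2 := ENNReal.toReal_mono hω.ne h1
  simpa using h2

theorem tendsto_measure_zero_of_antitone {Ω : Type*} [MeasurableSpace Ω] {P : Measure Ω}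
    [IsFiniteMeasure P] {A : ℕ → Set Ω} (hA : ∀ n, MeasurableSet (A n)) (hanti : Antitone A)
    (hempty : ∀ ω, ∃ n, ω ∉ A n) : Tendsto (fun n => P (A n)) atTop (𝓝 0) := by
  have h := tendsto_measure_iInter_atTop (μ := P) (fun n => (hA n).nullMeasurableSet) hanti
    ⟨0, measure_ne_top _ _⟩
  have h0 : ⋂ n, A n = ∅ := Set.eq_empty_of_forall_notMem fun ω hω =>
    (hempty ω).elim fun n hn => hn (Set.mem_iInter.1 hω n)
  rwa [h0, measure_empty] at h

theorem exists_forall_normSq_lt {Ω : Type*} {d : ℕ} {Θ : ℕ → Ω → EuclideanSpace ℝ (Fin d)} {ω : Ω}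
    (hω : ω ∈ boundedEvent Θ) : ∃ R : ℕ, ∀ k, ‖Θ k ω‖ ^ 2 < R := by
  set b := ⨆ (n : ℕ) (_ : 1 ≤ n), ‖Θ n ω‖ₑ with hb
  have hbt : b < ∞ := hω
  -- Index 0 is not part of the supremum defining `boundedEvent`.
  have h1 : ∀ k, ‖Θ k ω‖ ≤ max ‖Θ 0 ω‖ b.toReal := by
    intro k
    rcases Nat.eq_zero_or_pos k with rfl | hk
    · exact le_max_left _ _
    · refine le_max_of_le_right ?_
      have h2 : ‖Θ k ω‖ₑ ≤ b := le_iSup₂_of_le k hk le_rfl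
      simpa using ENNReal.toReal_mono hbt.ne h2
  obtain ⟨R, hR⟩ := exists_nat_gt ((max ‖Θ 0 ω‖ b.toReal) ^ 2)
  exact ⟨R, fun k => lt_of_le_of_lt (pow_le_pow_left₀ (norm_nonneg _) (h1 k) 2) hR⟩

theorem timeChange_mono {Ω : Type*} {γ : ℕ → Ω → ℝ} {ω : Ω}
    (htop : Tendsto (fun n => elapsed γ n ω) atTop atTop) : Monotone fun t => timeChange γ t ω := by
  intro t u htu
  have hne : {n : ℕ | u ≤ ∑ m ∈ Finset.Icc 1 n, γ m ω}.Nonempty :=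
    (htop.eventually_ge_atTop u).exists
  exact Nat.sInf_le (htu.trans (Nat.sInf_mem hne))

/-! ### Choice of constants and convergence on windows. -/

/-- Convergence to zero, in probability and uniformly on clock windows of length `δ`, on the event
that the path is bounded. -/
theorem tendsto_lintegral_window {Ω : Type*} {mΩ : MeasurableSpace Ω} {P : Measure Ω}
    [IsProbabilityMeasure P] {ℱ : Filtration ℕ mΩ} {γ : ℕ → Ω → ℝ}
    (hγ_nonneg : ∀ n ω, 0 ≤ γ (n + 1) ω)
    (hγ_meas : ∀ n, Measurable[ℱ n] (γ (n + 1)))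
    (hγ_lim : ∀ ω, Tendsto (fun n => γ n ω) atTop (𝓝 0))
    (hγ_sum : ∀ ω, Tendsto (fun n => elapsed γ n ω) atTop atTop)
    (hγ_anti : ∀ n ω, γ (n + 2) ω ≤ γ (n + 1) ω) {d : ℕ}
    {g : EuclideanSpace ℝ (Fin d) → EuclideanSpace ℝ (Fin d)}
    (hg_meas : Measurable g) (hg_bdd : LocallyBoundedFun g) {c : ℝ} (hc : 0 < c)
    (hg_coer : ∀ θ, inner ℝ θ (g θ) ≤ -c * ‖θ‖ ^ 2)
    {D : ℕ → Ω → EuclideanSpace ℝ (Fin d)} (hD_meas : ∀ n, Measurable (D (n + 1)))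
    (hD_int : ∀ n, Integrable (D (n + 1)) P) (hD_mart : ∀ n, P[D (n + 1) | ℱ n] =ᵐ[P] 0)
    {Θ : ℕ → Ω → EuclideanSpace ℝ (Fin d)} (hΘ_adapted : ∀ n, Measurable[ℱ n] (Θ n))
    (hΘ_rec : ∀ n ω, Θ (n + 1) ω
      = Θ n ω + γ (n + 1) ω • g (Θ n ω) + γ (n + 1) ω • D (n + 1) ω)
    (hD_sup : ∀ R : ℝ,
      (∫⁻ ω, ⨆ (n : ℕ) (_ : 1 ≤ n) (_ : (n : ℕ∞) ≤ exitTime Θ R ω), ‖D n ω‖ₑ ^ 2 ∂P) < ∞)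
    (δ : ℝ) :
    Tendsto (fun t : ℝ => ∫⁻ ω, min 1 ((boundedEvent Θ).indicator
      (fun ω => ⨆ m ∈ Set.Icc (timeChange γ t ω) (timeChange γ (t + δ) ω), ‖Θ m ω‖ₑ) ω) ∂P)
      atTop (𝓝 0) := by
  have hΘm : ∀ n, Measurable (Θ n) := fun n => (hΘ_adapted n).mono (ℱ.le n) le_rfl
  have hsm : ∀ n, Measurable (elapsed γ n) := fun n =>
    (measurable_elapsed hγ_meas n).mono (ℱ.le n) le_rfl
  have hγm : ∀ n, Measurable (γ (n + 1)) := fun n => (hγ_meas n).mono (ℱ.le n) le_rfl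
  refine ENNReal.tendsto_nhds_zero.2 fun η hη => ?_
  obtain ⟨x, hx0, hxη⟩ := ENNReal.lt_iff_exists_nnreal_btwn.1 hη
  -- Six shares: one for the threshold κ on the norm, one for each of `H₁`, `H₂`, `H₃`, two for
  -- `H₄`.
  set κ : ℝ := x / 6 with hκ
  have hx : (0 : ℝ) < x := by exact_mod_cast hx0
  have hκ0 : 0 < κ := by positivity
  have hκe : (0 : ℝ≥0∞) < ENNReal.ofReal κ := ENNReal.ofReal_pos.2 hκ0
  -- localization in space
  obtain ⟨R, hR⟩ : ∃ R : ℕ,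
      P ((⋃ j : ℕ, {ω | ∀ k, ‖Θ k ω‖ ^ 2 < j}) \ {ω | ∀ k, ‖Θ k ω‖ ^ 2 < R})
        ≤ ENNReal.ofReal κ := by
    have hm : ∀ j : ℕ, MeasurableSet {ω | ∀ k, ‖Θ k ω‖ ^ 2 < j} := by
      intro j
      simp only [Set.ofPred_forall]
      exact MeasurableSet.iInter fun k =>
        measurableSet_lt ((hΘm k).norm.pow_const 2) measurable_const
    have h := tendsto_measure_zero_of_antitone (P := P)
      (A := fun R : ℕ => (⋃ j : ℕ, {ω | ∀ k, ‖Θ k ω‖ ^ 2 < j}) \ {ω | ∀ k, ‖Θ k ω‖ ^ 2 < R})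
      (fun R => (MeasurableSet.iUnion hm).diff (hm R))
      (fun a b hab => Set.sdiff_subset_sdiff_right fun ω hω k =>
        (hω k).trans_le (by exact_mod_cast hab))
      (fun ω => by
        by_cases hω : ω ∈ ⋃ j : ℕ, {ω | ∀ k, ‖Θ k ω‖ ^ 2 < j}
        · obtain ⟨j, hj⟩ := Set.mem_iUnion.1 hω
          exact ⟨j, fun h => h.2 hj⟩
        · exact ⟨0, fun h => hω h.1⟩)
    exact (ENNReal.tendsto_nhds_zero.1 h _ hκe).exists
  obtain ⟨G, hG⟩ := hg_bdd.exists_bound R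
  obtain ⟨M, hM, hM0, hDM⟩ := exists_integrable_bound hΘm hD_meas (hD_sup R)
  -- small step sizes
  set I : ℝ := ∫ ω, (G ^ 2 + M ω) ∂P with hI
  have hI0 : 0 ≤ I := integral_nonneg fun ω => add_nonneg (sq_nonneg _) (hM0 ω)
  -- The factor of ε in `measure_exceed_le` for `T = t + δ`, `l = κ ^ 2`, after cancelling exp(2ct).
  set a : ℝ := Real.exp (2 * c * (δ + 2)) / (2 * c) * I / κ ^ 2 with ha
  have ha0 : 0 ≤ a := by positivity
  set ε : ℝ := min 1 (κ / (a + 1)) with hε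
  have hε0 : 0 < ε := lt_min one_pos (by positivity)
  have hεa : ε * a ≤ κ := by
    calc ε * a ≤ κ / (a + 1) * (a + 1) := by
          gcongr
          · exact min_le_right _ _
          · linarith
      _ = κ := by field_simp
  obtain ⟨n₀, hn₀⟩ : ∃ n₀, P {ω | ε < γ (n₀ + 1) ω} ≤ ENNReal.ofReal κ := by
    have h := tendsto_measure_zero_of_antitone (P := P) (A := fun n => {ω | ε < γ (n + 1) ω})
      (fun n => measurableSet_lt measurable_const (hγm n))
      (antitone_nat_of_succ_le fun n ω hω => lt_of_lt_of_le hω (hγ_anti n ω))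
      (fun ω => by
        obtain ⟨n, hn⟩ :=
          (((hγ_lim ω).comp (tendsto_add_atTop_nat 1)).eventually_lt_const hε0).exists
        exact ⟨n, fun h => lt_asymm h hn⟩)
    exact (ENNReal.tendsto_nhds_zero.1 h _ hκe).exists
  -- the clock at the starting index
  obtain ⟨K, hK⟩ : ∃ K : ℕ, P {ω | (K : ℝ) < elapsed γ n₀ ω} ≤ ENNReal.ofReal κ := by
    have h := tendsto_measure_zero_of_antitone (P := P)
      (A := fun K : ℕ => {ω | (K : ℝ) < elapsed γ n₀ ω})
      (fun n => measurableSet_lt measurable_const (hsm n₀))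
      (fun i j hij ω hω => (Nat.cast_le.2 hij : (i : ℝ) ≤ j).trans_lt hω)
      (fun ω => (exists_nat_gt (elapsed γ n₀ ω)).imp fun n hn h => lt_asymm h hn)
    exact (ENNReal.tendsto_nhds_zero.1 h _ hκe).exists
  have hlim : Tendsto (fun t : ℝ => Real.exp (2 * c * K) * R / κ ^ 2 * Real.exp (-(2 * c * t)))
      atTop (𝓝 0) := by
    rw [← mul_zero (Real.exp (2 * c * K) * R / κ ^ 2)]
    refine Tendsto.const_mul _ (Real.tendsto_exp_neg_atTop_nhds_zero.comp ?_)
    exact tendsto_id.const_mul_atTop (by positivity)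
  filter_upwards [hlim.eventually_lt_const hκ0, eventually_gt_atTop (K : ℝ)] with t ht htK
  have hmain := measure_exceed_le hγ_nonneg hγ_meas hγ_anti hg_meas hc hg_coer hG hD_int hD_mart
    hΘ_adapted hΘ_rec hM hM0 hDM n₀ (T := t + δ) (l := κ ^ 2) (Nat.cast_nonneg R) hε0.le
    (min_le_left _ _) htK (by positivity)
  set H₁ : Set Ω := (⋃ j : ℕ, {ω | ∀ k, ‖Θ k ω‖ ^ 2 < j}) \ {ω | ∀ k, ‖Θ k ω‖ ^ 2 < R}
  set H₂ : Set Ω := {ω | ε < γ (n₀ + 1) ω}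
  set H₃ : Set Ω := {ω | (K : ℝ) < elapsed γ n₀ ω}
  set H₄ : Set Ω := {ω | γ (n₀ + 1) ω ≤ ε ∧ elapsed γ n₀ ω ≤ K ∧ (∀ k, ‖Θ k ω‖ ^ 2 < R) ∧
        ∃ m, t ≤ elapsed γ m ω ∧ (∀ j < m, elapsed γ j ω < t + δ) ∧ κ ^ 2 ≤ ‖Θ m ω‖ ^ 2}
  have h4 : P H₄ ≤ ENNReal.ofReal (2 * κ) := by
    refine hmain.trans (ENNReal.ofReal_le_ofReal ?_)
    rw [← hI]
    have e : (Real.exp (2 * c * K) * R + ε * (Real.exp (2 * c * (t + δ + 2)) / (2 * c)) * I)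
        / (Real.exp (2 * c * t) * κ ^ 2)
        = Real.exp (2 * c * K) * R / κ ^ 2 * Real.exp (-(2 * c * t)) + ε * a := by
      rw [ha, show 2 * c * (t + δ + 2) = 2 * c * t + 2 * c * (δ + 2) by ring,
        Real.exp_add (2 * c * t), Real.exp_neg]
      field_simp
    rw [e]
    linarith
  have hpt : ∀ ω, min 1 ((boundedEvent Θ).indicator
      (fun ω => ⨆ m ∈ Set.Icc (timeChange γ t ω) (timeChange γ (t + δ) ω), ‖Θ m ω‖ₑ) ω)
      ≤ ENNReal.ofReal κ + (H₁ ∪ H₂ ∪ H₃ ∪ H₄).indicator (fun _ => 1) ω := by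
    intro ω
    by_cases hω : ω ∈ H₁ ∪ H₂ ∪ H₃ ∪ H₄
    · rw [Set.indicator_of_mem hω]
      exact (min_le_left _ _).trans le_add_self
    rw [Set.indicator_of_notMem hω, add_zero]
    refine (min_le_right _ _).trans ?_
    by_cases hE : ω ∈ boundedEvent Θ
    swap
    · simp [Set.indicator_of_notMem hE]
    rw [Set.indicator_of_mem hE]
    refine iSup₂_le fun m hm => ?_
    rw [← ofReal_norm]
    refine ENNReal.ofReal_le_ofReal (not_lt.1 fun hlt => hω ?_)
    by_cases h1 : ω ∈ H₁
    · exact Or.inl (Or.inl (Or.inl h1))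
    by_cases h2 : ω ∈ H₂
    · exact Or.inl (Or.inl (Or.inr h2))
    by_cases h3 : ω ∈ H₃
    · exact Or.inl (Or.inr h3)
    -- At the right end of the window the clock may exceed t + δ; only at earlier indices is it
    -- below, which is all that `H₄` demands.
    refine Or.inr ⟨not_lt.1 h2, not_lt.1 h3, ?_, m,
      le_elapsed_of_timeChange_le hγ_nonneg (hγ_sum ω) hm.1,
      fun j hj => elapsed_lt_of_lt_timeChange (hj.trans_le hm.2), by gcongr⟩
    by_contra hcon
    exact h1 ⟨Set.mem_iUnion.2 (exists_forall_normSq_lt hE), hcon⟩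
  calc _ ≤ ∫⁻ ω, (ENNReal.ofReal κ + (H₁ ∪ H₂ ∪ H₃ ∪ H₄).indicator (fun _ => 1) ω) ∂P :=
        lintegral_mono hpt
    _ ≤ ENNReal.ofReal κ + P (H₁ ∪ H₂ ∪ H₃ ∪ H₄) := by
        rw [lintegral_add_left measurable_const]
        gcongr
        · simp
        · exact (lintegral_indicator_const_le _ _).trans (by simp)
    _ ≤ ENNReal.ofReal κ + (P H₁ + P H₂ + P H₃ + P H₄) := by
        gcongr
        refine (measure_union_le _ _).trans (add_le_add_left ?_ _)
        refine (measure_union_le _ _).trans (add_le_add_left ?_ _)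
        exact measure_union_le _ _
    _ ≤ ENNReal.ofReal κ + (ENNReal.ofReal κ + ENNReal.ofReal κ + ENNReal.ofReal κ
          + ENNReal.ofReal (2 * κ)) := by gcongr
    _ = ENNReal.ofReal x := by
        rw [← ENNReal.ofReal_add, ← ENNReal.ofReal_add, ← ENNReal.ofReal_add,
          ← ENNReal.ofReal_add] <;> try positivity
        congr 1
        rw [hκ]; ring
    _ ≤ η := by simpa using hxη.le

end SGD

/-! ### The three claims. -/

/-- The processes `γ` and `D` are indexed by `n ≥ 1`; their values at index `0` play no role. -/
theorem mainTheorem3 {Ω : Type*} {mΩ : MeasurableSpace Ω} (P : Measure Ω) [IsProbabilityMeasure P]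
    (ℱ : Filtration ℕ mΩ)
    (γ : ℕ → Ω → ℝ)
    (hγ_nonneg : ∀ n ω, 0 ≤ γ (n + 1) ω)
    (hγ_meas : ∀ n, Measurable[ℱ n] (γ (n + 1)))
    (hγ_lim : ∀ ω, Tendsto (fun n => γ n ω) atTop (𝓝 0))
    (hγ_sum : ∀ ω, Tendsto (fun n : ℕ => ∑ m ∈ Finset.Icc 1 n, γ m ω) atTop atTop)
    (hγ_anti : ∀ n ω, γ (n + 2) ω ≤ γ (n + 1) ω)
    (d : ℕ) (hd : 1 ≤ d)
    (g : EuclideanSpace ℝ (Fin d) → EuclideanSpace ℝ (Fin d))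
    (hg_meas : Measurable g) (hg_bdd : SGD.LocallyBoundedFun g)
    (c : ℝ) (hc : 0 < c)
    (hg_coer : ∀ θ, inner ℝ θ (g θ) ≤ -c * ‖θ‖ ^ 2)
    (D : ℕ → Ω → EuclideanSpace ℝ (Fin d))
    (hD_meas : ∀ n, Measurable (D (n + 1)))
    (hD_int : ∀ n, Integrable (D (n + 1)) P)
    (hD_mart : ∀ n, P[D (n + 1) | ℱ n] =ᵐ[P] 0)
    (Θ : ℕ → Ω → EuclideanSpace ℝ (Fin d))
    (hΘ_adapted : ∀ n, Measurable[ℱ n] (Θ n))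
    (hΘ_rec : ∀ n ω, Θ (n + 1) ω
      = Θ n ω + γ (n + 1) ω • g (Θ n ω) + γ (n + 1) ω • D (n + 1) ω)
    (hD_sup : ∀ R : ℝ,
      (∫⁻ ω, ⨆ (n : ℕ) (_ : 1 ≤ n) (_ : (n : ℕ∞) ≤ SGD.exitTime Θ R ω), ‖D n ω‖ₑ ^ 2 ∂P) < ∞) :
    (∀ δ : ℝ, 0 < δ →
      limsup (fun n : ℕ => ∫⁻ ω, min 1 ((SGD.boundedEvent Θ).indicator
        (fun ω => ‖Θ (SGD.timeChange γ (n * δ) ω) ω‖ₑ) ω) ∂P) atTop = 0) ∧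
    (∀ δ : ℝ, 0 < δ →
      limsup (fun n : ℕ => ∫⁻ ω, min 1 ((SGD.boundedEvent Θ).indicator
        (fun ω => ⨆ m ∈ Set.Icc (SGD.timeChange γ (n * δ) ω)
          (SGD.timeChange γ ((n + 1) * δ) ω), ‖Θ m ω‖ₑ) ω) ∂P) atTop = 0) ∧
    limsup (fun t : ℝ => ∫⁻ ω, min 1 ((SGD.boundedEvent Θ).indicator
      (fun ω => ‖Θ (SGD.timeChange γ t ω) ω‖ₑ) ω) ∂P) atTop = 0 := by
  have key := SGD.tendsto_lintegral_window hγ_nonneg hγ_meas hγ_lim hγ_sum hγ_anti hg_meas hg_bdd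
    hc hg_coer hD_meas hD_int hD_mart hΘ_adapted hΘ_rec hD_sup
  have point : Tendsto (fun t : ℝ => ∫⁻ ω, min 1 ((SGD.boundedEvent Θ).indicator
      (fun ω => ‖Θ (SGD.timeChange γ t ω) ω‖ₑ) ω) ∂P) atTop (𝓝 0) := by
    -- The left endpoint belongs to the window; its length 1 is arbitrary.
    refine tendsto_of_tendsto_of_tendsto_of_le_of_le tendsto_const_nhds (key 1)
      (fun _ => zero_le) fun t => lintegral_mono fun ω => min_le_min_left _ ?_
    refine Set.indicator_le_indicator ?_
    exact le_iSup₂_of_le (SGD.timeChange γ t ω)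
      ⟨le_rfl, SGD.timeChange_mono (hγ_sum ω) (by linarith)⟩ le_rfl
  have clock : ∀ δ : ℝ, 0 < δ → Tendsto (fun n : ℕ => (n : ℝ) * δ) atTop atTop := fun δ hδ =>
    tendsto_natCast_atTop_atTop.atTop_mul_const hδ
  refine ⟨fun δ hδ => (point.comp (clock δ hδ)).limsup_eq, fun δ hδ => ?_, point.limsup_eq⟩
  refine Tendsto.limsup_eq ?_
  simp only [add_mul, one_mul]
  exact (key δ).comp (clock δ hδ)
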